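/- Let $K$ be a commutative ring and let $m,n\ge 0$ be integers. Put $P=K[y_1,\dots,y_m]$, $D=K[x_{ik}: 1\le i\le n,\ 1\le k\le m]$ and $A=K[\xi_{kij}: 1\le k\le m,\ 1\le i,j\le n]$. Let $A_P$ be the quotient of $A$ by the ideal generated by the entries of the matrices $\xi_k\xi_h-\xi_h\xi_k$ $(1\le k,h\le m)$, where $\xi_k=(\xi_{kij})_{i,j}$, and let $\xi'_k$ be the image of $\xi_k$ in $\mathrm{Mat}(n,A_P)$ (the generic commuting $n\times n$ matrices). Let $C_P\subseteq A_P$ be the $K$-subalgebra generated by the coefficients of the characteristic polynomials $\det(tI_n-f(\xi'_1,\dots,\xi'_m))$ for $f\in P$. Let $\mathrm{TS}^nP=(P^{\otimes n})^{\mathfrak S_n}$ (tensor powers over $K$, $\mathfrak S_n$ permuting the factors), and let $D^{\mathfrak S_n}$ be the ring of multisymmetric functions, i.e. the invariants of $D$ under $\sigma(x_{ik})=x_{\sigma(i)k}$. There is a $K$-algebra homomorphism $\alpha:\mathrm{TS}^nP\to A_P$ with $$\alpha(f^{\otimes n})=\det\bigl(f(\xi'_1,\dots,\xi'_m)\bigr)\quad\text{for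 all } f\in P,$$ and, more precisely, representing $f\mapsto\det(f(\xi'_1,\dots,\xi'_m))$ as a polynomial law: for all $r\ge 0$ and $f_1,\dots,f_r\in P$, applying $\alpha$ to the coefficients of $(t_1f_1+\dots+t_rf_r)^{\otimes n}$, a polynomial in the indeterminates $t_1,\dots,t_r$ with coefficients in $\mathrm{TS}^nP$, gives $\det\bigl(\sum_j t_jf_j(\xi'_1,\dots,\xi'_m)\bigr)$. The homomorphism $\alpha$ is unique with the latter property, and it is an isomorphism of $K$-algebras from $\mathrm{TS}^nP$ onto $C_P$. Moreover the $K$-algebra homomorphism $D\to P^{\otimes n}$, $x_{ik}\mapsto 1^{\otimes (i-1)}\otimes y_k\otimes 1^{\otimes(n-i)}$, restricts to an isomorphism $D^{\mathfrak S_n}\cong\mathrm{TS}^nP$, and its composition with $\alpha$ is an isomorphism $D^{\mathfrak S_n}\cong C_P$. -/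

import Mathlib

open scoped TensorProduct

noncomputable section

/-! ### The commuting scheme and the generic commuting matrices -/

/-- `A = K[ξ_{kij}]`; the variable `ξ_{kij}` is `X (k, i, j)`. -/
abbrev GenericRing (K : Type*) [CommRing K] (m n : ℕ) : Type _ :=
  MvPolynomial (Fin m × Fin n × Fin n) K

/-- The generic matrix `ξ_k`. -/
def genericMatrix (K : Type*) [CommRing K] (m n : ℕ) (k : Fin m) :
    Matrix (Fin n) (Fin n) (GenericRing K m n) :=
  Matrix.of fun i j => MvPolynomial.X (k, i, j)

/-- The ideal of `A` generated by the entries of all `ξ_k ξ_h - ξ_h ξ_k`. -/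
def commutingIdeal (K : Type*) [CommRing K] (m n : ℕ) : Ideal (GenericRing K m n) :=
  Ideal.span {a | ∃ (k h : Fin m) (i j : Fin n),
    a = (genericMatrix K m n k * genericMatrix K m n h
      - genericMatrix K m n h * genericMatrix K m n k) i j}

/-- `A_P`, the coordinate ring of the scheme of `m`-tuples of commuting `n × n` matrices. -/
abbrev CommutingRing (K : Type*) [CommRing K] (m n : ℕ) : Type _ :=
  GenericRing K m n ⧸ commutingIdeal K m n

/-- The generic commuting matrix `ξ'_k`, with entries the classes of the `ξ_{kij}`. -/
def commutingMatrix (K : Type*) [CommRing K] (m n : ℕ) (k : Fin m) :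
    Matrix (Fin n) (Fin n) (CommutingRing K m n) :=
  (genericMatrix K m n k).map (Ideal.Quotient.mk (commutingIdeal K m n))

theorem commutingMatrix_comm (K : Type*) [CommRing K] (m n : ℕ) (k h : Fin m) :
    commutingMatrix K m n k * commutingMatrix K m n h
      = commutingMatrix K m n h * commutingMatrix K m n k := by
  unfold commutingMatrix
  rw [← Matrix.map_mul, ← Matrix.map_mul]
  ext i j
  rw [Matrix.map_apply, Matrix.map_apply, Ideal.Quotient.eq]
  exact Ideal.subset_span ⟨k, h, i, j, rfl⟩

/-- The representation `π_P : P = K[y_1, …, y_m] → Mat(n, A_P)`, `y_k ↦ ξ'_k`, that is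
`f ↦ f(ξ'_1, …, ξ'_m)`: evaluation in the commutative subalgebra generated by the `ξ'_k`. -/
def piRep (K : Type*) [CommRing K] (m n : ℕ) :
    MvPolynomial (Fin m) K →ₐ[K] Matrix (Fin n) (Fin n) (CommutingRing K m n) :=
  letI : CommRing (Algebra.adjoin K (Set.range (commutingMatrix K m n))) :=
    { (inferInstance : Ring (Algebra.adjoin K (Set.range (commutingMatrix K m n)))) with
      mul_comm := (Algebra.isMulCommutative_adjoin K (by
        rintro _ ⟨k, rfl⟩ _ ⟨h, rfl⟩
        exact commutingMatrix_comm K m n k h)).is_comm.comm }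
  (Algebra.adjoin K (Set.range (commutingMatrix K m n))).val.comp
    (MvPolynomial.aeval fun k =>
      (⟨commutingMatrix K m n k, Algebra.subset_adjoin ⟨k, rfl⟩⟩ :
        Algebra.adjoin K (Set.range (commutingMatrix K m n))))

theorem piRep_X (K : Type*) [CommRing K] (m n : ℕ) (k : Fin m) :
    piRep K m n (MvPolynomial.X k) = commutingMatrix K m n k := by
  simp [piRep]

/-- `C_P`, the subalgebra of `A_P` generated by the coefficients of the characteristic
polynomials `det(t I_n - f(ξ'_1, …, ξ'_m))`, `f ∈ P`. -/
def charSubalgebra (K : Type*) [CommRing K] (m n : ℕ) : Subalgebra K (CommutingRing K m n) :=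
  Algebra.adjoin K {c | ∃ (f : MvPolynomial (Fin m) K) (j : ℕ), c = (piRep K m n f).charpoly.coeff j}

/-! ### Symmetric tensors -/

/-- The action of `σ ∈ S_n` on `R^{⊗n}`: the `i`-th factor is moved to position `σ i`. -/
def permTensor (K R : Type*) [CommRing K] [CommRing R] [Algebra K R] (n : ℕ)
    (σ : Equiv.Perm (Fin n)) : (⨂[K] _ : Fin n, R) →ₐ[K] (⨂[K] _ : Fin n, R) :=
  PiTensorProduct.liftAlgHom
    ((PiTensorProduct.tprod K (s := fun _ : Fin n => R)).domDomCongr σ.symm)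
    rfl (fun _ _ => (PiTensorProduct.tprod_mul_tprod _ _).symm)

theorem permTensor_tprod (K R : Type*) [CommRing K] [CommRing R] [Algebra K R] (n : ℕ)
    (σ : Equiv.Perm (Fin n)) (v : Fin n → R) :
    permTensor K R n σ (PiTensorProduct.tprod K v)
      = PiTensorProduct.tprod K (fun i => v (σ.symm i)) :=
  PiTensorProduct.lift.tprod _

/-- `TS^n R`, the algebra of symmetric tensors of order `n` over the `K`-algebra `R`. -/
def symTensor (K R : Type*) [CommRing K] [CommRing R] [Algebra K R] (n : ℕ) :
    Subalgebra K (⨂[K] _ : Fin n, R) where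
  carrier := {z | ∀ σ : Equiv.Perm (Fin n), permTensor K R n σ z = z}
  mul_mem' ha hb σ := by rw [map_mul, ha σ, hb σ]
  add_mem' ha hb σ := by rw [map_add, ha σ, hb σ]
  algebraMap_mem' r σ := AlgHom.commutes _ r

/-- The symmetric tensor `f^{⊗n} = f ⊗ ⋯ ⊗ f`. -/
def powTensor (K : Type*) {R : Type*} [CommRing K] [CommRing R] [Algebra K R] (n : ℕ) (f : R) :
    symTensor K R n :=
  ⟨PiTensorProduct.tprod K fun _ => f, fun σ => permTensor_tprod K R n σ _⟩

open Classical in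
/-- The sum of the tensors `f_{c(1)} ⊗ ⋯ ⊗ f_{c(n)}` over all `c` taking each value `j` exactly
`a j` times, i.e. the coefficient of `t^a` in `(t_1 f_1 + ⋯ + t_r f_r)^{⊗n}`. -/
def mixedTensor (K : Type*) {R : Type*} [CommRing K] [CommRing R] [Algebra K R] (n : ℕ) {r : ℕ}
    (f : Fin r → R) (a : Fin r →₀ ℕ) : symTensor K R n :=
  ⟨∑ c : Fin n → Fin r, if ∑ i, Finsupp.single (c i) 1 = a
      then PiTensorProduct.tprod K (fun i => f (c i)) else 0, fun σ => by
    rw [map_sum]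
    refine Fintype.sum_equiv (Equiv.arrowCongr σ (Equiv.refl _)) _ _ fun c => ?_
    have h : ∑ i, Finsupp.single (c (σ.symm i)) 1 = ∑ i, Finsupp.single (c i) (1 : ℕ) :=
      Equiv.sum_comp σ.symm fun i => Finsupp.single (c i) (1 : ℕ)
    simp [apply_ite (permTensor K R n σ), permTensor_tprod, h]⟩

/-- `α` represents the multiplicative polynomial law `det ∘ π_P`: it maps `(∑ t_j f_j)^{⊗n}` to
`det (∑ t_j f_j(ξ'_1, …, ξ'_m))`, coefficientwise in the indeterminates `t_1, …, t_r`. -/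
def RepresentsDet (K : Type*) [CommRing K] (m n : ℕ)
    (α : symTensor K (MvPolynomial (Fin m) K) n →ₐ[K] CommutingRing K m n) : Prop :=
  ∀ (r : ℕ) (f : Fin r → MvPolynomial (Fin m) K) (a : Fin r →₀ ℕ),
    α (mixedTensor K n f a) = MvPolynomial.coeff a
      (Matrix.det (∑ j, (MvPolynomial.X j : MvPolynomial (Fin r) (CommutingRing K m n)) •
        (piRep K m n (f j)).map MvPolynomial.C))

/-! ### Multisymmetric functions -/

/-- `D^{S_n}`, the invariants of `D = K[x_{ik}]` under `σ(x_{ik}) = x_{σ(i)k}`; the variable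
`x_{ik}` is `X (i, k)`. -/
def multisymmetric (K : Type*) [CommRing K] (m n : ℕ) :
    Subalgebra K (MvPolynomial (Fin n × Fin m) K) where
  carrier := {d | ∀ σ : Equiv.Perm (Fin n), MvPolynomial.rename (Prod.map σ id) d = d}
  mul_mem' ha hb σ := by rw [map_mul, ha σ, hb σ]
  add_mem' ha hb σ := by rw [map_add, ha σ, hb σ]
  algebraMap_mem' r σ := AlgHom.commutes _ r

/-- The algebra map `D → P^{⊗n}`, `x_{ik} ↦ 1 ⊗ ⋯ ⊗ y_k ⊗ ⋯ ⊗ 1` (`y_k` in position `i`). -/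
def multisymToTensor (K : Type*) [CommRing K] (m n : ℕ) :
    MvPolynomial (Fin n × Fin m) K →ₐ[K] (⨂[K] _ : Fin n, MvPolynomial (Fin m) K) :=
  MvPolynomial.aeval fun p =>
    PiTensorProduct.singleAlgHom (R := K) (A := fun _ : Fin n => MvPolynomial (Fin m) K) p.1
      (MvPolynomial.X p.2)

end

/-!
Everything rests on the `K`-linear map `columnDet : P^{⊗n} → A_P` sending `v_1 ⊗ ⋯ ⊗ v_n` to the
determinant of the matrix whose `k`-th column is the `k`-th column of `v_k(ξ'_1, …, ξ'_m)`. The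
homomorphism `α` is its restriction to the symmetric tensors.

*Multiplicativity.* Expanding `det (∑ t_j F_j) · det W = det (∑ t_j F_j W)` along columns and
comparing coefficients of `t^a` shows `columnDet (z * w) = columnDet z * columnDet w` for
`z = mixedTensor K n f a` and every tensor `w`; taking `W = 1` gives the value of `columnDet` on
`mixedTensor K n f a`. Since `P` is free over `K`, the mixed tensors span `TS^n P`
(`span_mixedTensor`): the coordinates of a symmetric tensor in a basis of `P^{⊗n}` depend only on
the multiset of indices. This gives both the multiplicativity and the uniqueness of `α`.

*Injectivity.* Specializing `ξ'_k` to the diagonal matrix with entries `x_{1k}, …, x_{nk}` defines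
`A_P → D`, and its composite with `columnDet` is the inverse of the isomorphism `D ≅ P^{⊗n}`
(`diagonalPoint_columnDet`). That isomorphism is `S_n`-equivariant, so it also identifies
`D^{S_n}` with `TS^n P`.

*Image.* A coefficient of `det (t - f(ξ'))` is the value of `α` on a coefficient of
`(t · 1 - f)^{⊗n}`. Conversely, a polynomial `u ∈ P[t]` with `u(0) = 1` is, modulo any power of
`t`, a product of factors `1 + c t^k` with `c ∈ P`; hence the coefficients of `det (u(ξ'))` lie in
`C_P` (`coeff_det_polyToMatrix_mem_charSubalgebra`). For `u = 1 + ∑_j t^{(n+1)^j} f_j` the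
coefficient of `t^e`, `e = ∑_j a_j (n+1)^j` and `∑_j a_j = n`, is `α (mixedTensor K n f a)`, because
base `n + 1` expansions are unique.
-/

noncomputable section

/-! ### Column expansion of determinants -/

/-- The determinant of `(∑ j, s j • F j) * W`, expanded multilinearly in the columns. -/
theorem Matrix.det_sum_smul_mul_det {R ι N : Type*} [CommRing R] [Fintype ι] [DecidableEq N]
    [Fintype N] (s : ι → R) (F : ι → Matrix N N R) (W : Matrix N N R) :
    (∑ j, s j • F j).det * W.det
      = ∑ c : N → ι, (∏ k, s (c k)) * (Matrix.of fun i k => (F (c k) * W) i k).det := by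
  classical
  have h := (Matrix.detRowAlternating (n := N) (R := R)).toMultilinearMap.map_sum
    (fun (k : N) (j : ι) => s j • fun i => (F j * W) i k)
  have hl : (fun k => ∑ j, s j • fun i => (F j * W) i k) = ((∑ j, s j • F j) * W).transpose := by
    ext k i
    simp [Matrix.sum_mul, Finset.sum_apply, Matrix.sum_apply]
  rw [← Matrix.det_mul, ← Matrix.det_transpose]
  refine (congrArg _ hl.symm).trans (h.trans (Finset.sum_congr rfl fun c _ => ?_))
  rw [MultilinearMap.map_smul_univ, smul_eq_mul, ← Matrix.det_transpose (Matrix.of _)]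
  rfl

theorem Matrix.det_of_map_mul_map {R S ι N : Type*} [CommRing R] [CommRing S] [DecidableEq N]
    [Fintype N] (g : R →+* S) (F : ι → Matrix N N R) (W : Matrix N N R) (c : N → ι) :
    (Matrix.of fun i k => ((F (c k)).map g * W.map g) i k).det
      = g (Matrix.of fun i k => (F (c k) * W) i k).det := by
  rw [RingHom.map_det]
  congr 1
  ext i k
  simp [← Matrix.map_mul]

open Classical in
theorem Matrix.coeff_det_sum_X_smul_mul_det {R N : Type*} [CommRing R] [DecidableEq N] [Fintype N]
    {r : ℕ} (F : Fin r → Matrix N N R) (W : Matrix N N R) (a : Fin r →₀ ℕ) :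
    MvPolynomial.coeff a (∑ j, (MvPolynomial.X j : MvPolynomial (Fin r) R) •
        (F j).map MvPolynomial.C).det * W.det
      = ∑ c : N → Fin r, if ∑ k, Finsupp.single (c k) 1 = a
          then (Matrix.of fun i k => (F (c k) * W) i k).det else 0 := by
  have h := congrArg (MvPolynomial.coeff a) (Matrix.det_sum_smul_mul_det
    (fun j => (MvPolynomial.X j : MvPolynomial (Fin r) R)) (fun j => (F j).map MvPolynomial.C)
    (W.map MvPolynomial.C))
  have hW : (W.map (MvPolynomial.C : R →+* MvPolynomial (Fin r) R)).det = MvPolynomial.C W.det :=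
    (RingHom.map_det _ _).symm
  rw [hW, mul_comm _ (MvPolynomial.C _), MvPolynomial.coeff_C_mul, mul_comm W.det] at h
  rw [h, MvPolynomial.coeff_sum]
  refine Finset.sum_congr rfl fun c _ => ?_
  rw [Matrix.det_of_map_mul_map MvPolynomial.C F W c, mul_comm, MvPolynomial.coeff_C_mul]
  have : ∏ k, (MvPolynomial.X (c k) : MvPolynomial (Fin r) R)
      = MvPolynomial.monomial (∑ k, Finsupp.single (c k) 1) 1 := by
    rw [MvPolynomial.monomial_sum_one]; rfl
  rw [this, MvPolynomial.coeff_monomial]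
  split_ifs <;> simp

theorem Matrix.coeff_det_sum_X_pow_smul {R ι N : Type*} [CommRing R] [DecidableEq N] [Fintype N]
    [Fintype ι] (F : ι → Matrix N N R) (w : ι → ℕ) (e : ℕ) :
    (∑ j, (Polynomial.X ^ w j : Polynomial R) • (F j).map Polynomial.C).det.coeff e
      = ∑ c : N → ι, if ∑ k, w (c k) = e then (Matrix.of fun i k => F (c k) i k).det else 0 := by
  have h := congrArg (Polynomial.coeff · e) (Matrix.det_sum_smul_mul_det
    (fun j => (Polynomial.X ^ w j : Polynomial R)) (fun j => (F j).map Polynomial.C)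
    ((1 : Matrix N N R).map Polynomial.C))
  have h1 : ((1 : Matrix N N R).map (Polynomial.C : R →+* Polynomial R)).det = 1 := by simp
  simp only [h1, mul_one] at h
  rw [h, Polynomial.finsetSum_coeff]
  refine Finset.sum_congr rfl fun c _ => ?_
  rw [Matrix.det_of_map_mul_map Polynomial.C F 1 c, Polynomial.coeff_mul_C,
    Finset.prod_pow_eq_pow_sum, Polynomial.coeff_X_pow]
  simp [eq_comm]

/-! ### Mixed tensors span the symmetric tensors -/

/-- Two functions taking every value equally often differ by a permutation of the source. -/
theorem exists_perm_comp_eq {α β : Type*} [Fintype α] (c d : α → β)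
    (h : ∑ i, Finsupp.single (c i) (1 : ℕ) = ∑ i, Finsupp.single (d i) 1) :
    ∃ σ : Equiv.Perm α, d ∘ σ = c := by
  classical
  have hcard : ∀ b, Fintype.card {i // c i = b} = Fintype.card {i // d i = b} := fun b => by
    have := DFunLike.congr_fun h b
    simpa [Finsupp.finsetSum_apply, Finsupp.single_apply, Fintype.card_subtype] using this
  refine ⟨(Equiv.sigmaFiberEquiv c).symm.trans ((Equiv.sigmaCongrRight fun b =>
    Fintype.equivOfCardEq (hcard b)).trans (Equiv.sigmaFiberEquiv d)), ?_⟩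
  ext i
  exact (Fintype.equivOfCardEq (hcard (c i)) ⟨i, rfl⟩).2

theorem sum_smul_tprod_mem_symTensor {K R ι : Type*} [CommRing K] [CommRing R] [Algebra K R]
    [Fintype ι] {n : ℕ} (f : ι → R) (g : (Fin n → ι) → K)
    (hg : ∀ (c : Fin n → ι) (σ : Equiv.Perm (Fin n)), g (c ∘ σ) = g c) :
    ∑ c, g c • PiTensorProduct.tprod K (fun i => f (c i)) ∈ symTensor K R n := fun σ => by
  rw [map_sum]
  refine Fintype.sum_equiv (Equiv.arrowCongr σ (Equiv.refl _)) _ _ fun c => ?_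
  rw [map_smul, permTensor_tprod, ← hg c σ.symm]
  rfl

theorem repr_permTensor {K R κ : Type*} [CommRing K] [CommRing R] [Algebra K R]
    (b : Module.Basis κ K R) {n : ℕ} (σ : Equiv.Perm (Fin n)) (z : ⨂[K] _ : Fin n, R)
    (p : Fin n → κ) :
    (Basis.piTensorProduct fun _ : Fin n => b).repr (permTensor K R n σ z) p
      = (Basis.piTensorProduct fun _ : Fin n => b).repr z (p ∘ σ) := by
  induction z using PiTensorProduct.induction_on with
  | smul_tprod k v =>
    rw [map_smul, permTensor_tprod]
    simp only [map_smul, Finsupp.smul_apply, Basis.piTensorProduct_repr_tprod_apply]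
    congr 1
    exact Fintype.prod_equiv σ.symm _ _ fun i => by simp
  | add x y hx hy => simp only [map_add, Finsupp.add_apply, hx, hy]

/-- A symmetric tensor involves only finitely many vectors of a basis of `R`; these form the family
`f`, and grouping its terms by content writes it as a combination of tensors `mixedTensor K n f a`.
-/
theorem span_mixedTensor {K R : Type*} [CommRing K] [CommRing R] [Algebra K R] [Module.Free K R]
    (n : ℕ) :
    Submodule.span K {z : symTensor K R n | ∃ (r : ℕ) (f : Fin r → R) (a : Fin r →₀ ℕ),
      z = mixedTensor K n f a} = ⊤ := by
  classical
  rw [eq_top_iff]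
  rintro ⟨z, hz⟩ -
  set b := Module.Free.chooseBasis K R
  set B := Basis.piTensorProduct fun _ : Fin n => b
  have hsymm : ∀ (p : Fin n → _) (σ : Equiv.Perm (Fin n)), B.repr z (p ∘ σ) = B.repr z p :=
    fun p σ => by rw [← repr_permTensor, hz σ]
  set S := (B.repr z).support.biUnion fun p => Finset.univ.image p with hS
  let e := S.equivFin.symm
  have hinj : Function.Injective fun (c : Fin n → Fin S.card) i =>
      (e (c i) : Module.Free.ChooseBasisIndex K R) :=
    fun c d h => funext fun i => e.injective (Subtype.ext (congrFun h i))
  have hexp : z = ∑ c : Fin n → Fin S.card, B.repr z (fun i => e (c i)) •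
      PiTensorProduct.tprod K (fun i => b (e (c i))) := by
    calc z = ∑ p ∈ (B.repr z).support, B.repr z p • B p := by
          conv_lhs => rw [← B.linearCombination_repr z, Finsupp.linearCombination_apply,
            Finsupp.sum]
      _ = ∑ p ∈ Finset.univ.map ⟨_, hinj⟩, B.repr z p • B p := by
          refine Finset.sum_subset (fun p hp => ?_) fun p _ hp => ?_
          · have hpS : ∀ i, p i ∈ S := fun i =>
              Finset.mem_biUnion.2 ⟨p, hp, Finset.mem_image_of_mem p (Finset.mem_univ i)⟩
            exact Finset.mem_map.2 ⟨fun i => e.symm ⟨p i, hpS i⟩, Finset.mem_univ _, by ext i; simp⟩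
          · rw [Finsupp.notMem_support_iff.1 hp, zero_smul]
      _ = _ := by
          rw [Finset.sum_map]
          simp [B]
  have hcontent : ∀ c d : Fin n → Fin S.card,
      ∑ i, Finsupp.single (c i) (1 : ℕ) = ∑ i, Finsupp.single (d i) 1 →
      B.repr z (fun i => e (c i)) = B.repr z (fun i => e (d i)) := fun c d h => by
    obtain ⟨σ, rfl⟩ := exists_perm_comp_eq c d h
    exact hsymm (fun i => e (d i)) σ
  -- `k a` is the common coordinate of `z` at all index functions of content `a`.
  let content : (Fin n → Fin S.card) → (Fin S.card →₀ ℕ) := fun c => ∑ i, Finsupp.single (c i) 1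
  let k : (Fin S.card →₀ ℕ) → K := fun a =>
    if h : ∃ c, content c = a then B.repr z (fun i => e (h.choose i)) else 0
  have hk : ∀ c, k (content c) = B.repr z (fun i => e (c i)) := fun c => by
    have h : ∃ d, content d = content c := ⟨c, rfl⟩
    simp only [k, dif_pos h]
    exact hcontent _ _ h.choose_spec
  have hz' : (⟨z, hz⟩ : symTensor K R n) = ∑ a ∈ Finset.univ.image content,
      k a • mixedTensor K n (fun j => b (e j)) a := by
    apply Subtype.ext
    rw [AddSubmonoidClass.coe_finsetSum]
    simp only [mixedTensor, SetLike.val_smul, Finset.smul_sum]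
    rw [Finset.sum_comm]
    refine hexp.trans (Finset.sum_congr rfl fun c _ => ?_)
    rw [Finset.sum_eq_single_of_mem (content c)
      (Finset.mem_image_of_mem _ (Finset.mem_univ c))
      fun a _ ha => by rw [if_neg (Ne.symm ha), smul_zero], if_pos rfl, hk]
  rw [hz']
  exact Submodule.sum_mem _ fun a _ => Submodule.smul_mem _ _ (Submodule.subset_span ⟨_, _, a, rfl⟩)

/-! ### The determinant on the tensor power -/

/-- The `K`-linear map `P^{⊗n} → A_P` taking `v_1 ⊗ ⋯ ⊗ v_n` to the determinant of the matrix
whose `k`-th column is the `k`-th column of `v_k(ξ'_1, …, ξ'_m)`. Mathlib's determinant is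
multilinear in the rows, so the definition uses the transpose of this matrix. -/
def columnDet (K : Type*) [CommRing K] (m n : ℕ) :
    (⨂[K] _ : Fin n, MvPolynomial (Fin m) K) →ₗ[K] CommutingRing K m n :=
  PiTensorProduct.lift
    (((Matrix.detRowAlternating (n := Fin n)
      (R := CommutingRing K m n)).toMultilinearMap.restrictScalars K).compLinearMap fun k =>
        LinearMap.pi fun i => (Matrix.entryLinearMap K (CommutingRing K m n) i k).comp
          (piRep K m n).toLinearMap)

theorem columnDet_tprod (K : Type*) [CommRing K] (m n : ℕ) (v : Fin n → MvPolynomial (Fin m) K) :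
    columnDet K m n (PiTensorProduct.tprod K v)
      = (Matrix.of fun i k => piRep K m n (v k) i k).det := by
  rw [columnDet, PiTensorProduct.lift.tprod, ← Matrix.det_transpose]
  rfl

theorem columnDet_mixedTensor (K : Type*) [CommRing K] (m n : ℕ) {r : ℕ}
    (f : Fin r → MvPolynomial (Fin m) K) (a : Fin r →₀ ℕ) :
    columnDet K m n (mixedTensor K n f a) = MvPolynomial.coeff a
      (Matrix.det (∑ j, (MvPolynomial.X j : MvPolynomial (Fin r) (CommutingRing K m n)) •
        (piRep K m n (f j)).map MvPolynomial.C)) := by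
  classical
  have h := Matrix.coeff_det_sum_X_smul_mul_det (fun j => piRep K m n (f j)) 1 a
  simp only [Matrix.det_one, mul_one] at h
  rw [h, mixedTensor, map_sum]
  refine Finset.sum_congr rfl fun c _ => ?_
  split_ifs
  · exact columnDet_tprod K m n _
  · exact map_zero _

/-- Multiplicativity needs only one factor to be symmetric. On a mixed tensor it is the column
expansion of `det F · det W`, where `W` is the matrix of columns defining `columnDet w`. -/
theorem columnDet_mul {K : Type*} [CommRing K] {m n : ℕ}
    (z : symTensor K (MvPolynomial (Fin m) K) n) (w : ⨂[K] _ : Fin n, MvPolynomial (Fin m) K) :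
    columnDet K m n (z * w) = columnDet K m n z * columnDet K m n w := by
  classical
  have hz : z ∈ Submodule.span K {z : symTensor K (MvPolynomial (Fin m) K) n |
      ∃ (r : ℕ) (f : Fin r → _) (a : Fin r →₀ ℕ), z = mixedTensor K n f a} := by
    rw [span_mixedTensor]; trivial
  induction hz using Submodule.span_induction with
  | zero => simp
  | add x y _ _ hx hy => simp only [AddMemClass.coe_add, add_mul, map_add, hx, hy]
  | smul k x _ hx => simp only [SetLike.val_smul, smul_mul_assoc, map_smul, hx]
  | mem x hx =>
    obtain ⟨r, f, a, rfl⟩ := hx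
    induction w using PiTensorProduct.induction_on with
    | add x y hx hy => simp only [mul_add, map_add, hx, hy]
    | smul_tprod k v =>
      rw [mul_smul_comm, map_smul, map_smul, mul_smul_comm]
      congr 1
      rw [columnDet_mixedTensor, columnDet_tprod, Matrix.coeff_det_sum_X_smul_mul_det, mixedTensor,
        Finset.sum_mul, map_sum]
      refine Finset.sum_congr rfl fun c _ => ?_
      split_ifs
      · rw [PiTensorProduct.tprod_mul_tprod, columnDet_tprod]
        congr 1
        ext i k
        simp [Matrix.mul_apply]
      · simp

/-- The homomorphism `α : TS^n P → A_P`, the restriction of `columnDet` to symmetric tensors. -/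
def symTensorDet (K : Type*) [CommRing K] (m n : ℕ) :
    symTensor K (MvPolynomial (Fin m) K) n →ₐ[K] CommutingRing K m n :=
  AlgHom.ofLinearMap ((columnDet K m n).comp (symTensor K _ n).val.toLinearMap)
    (by
      have : (Matrix.of fun i k => piRep K m n 1 i k) = 1 := by ext i k; simp
      exact (columnDet_tprod K m n 1).trans ((congrArg Matrix.det this).trans Matrix.det_one))
    (fun z w => columnDet_mul z w)

theorem symTensorDet_powTensor (K : Type*) [CommRing K] (m n : ℕ) (f : MvPolynomial (Fin m) K) :
    symTensorDet K m n (powTensor K n f) = (piRep K m n f).det :=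
  columnDet_tprod K m n _

theorem representsDet_symTensorDet (K : Type*) [CommRing K] (m n : ℕ) :
    RepresentsDet K m n (symTensorDet K m n) := fun _ f a => columnDet_mixedTensor K m n f a

theorem RepresentsDet.unique {K : Type*} [CommRing K] {m n : ℕ}
    {α β : symTensor K (MvPolynomial (Fin m) K) n →ₐ[K] CommutingRing K m n}
    (hα : RepresentsDet K m n α) (hβ : RepresentsDet K m n β) : β = α := by
  apply AlgHom.toLinearMap_injective
  refine LinearMap.ext_on (span_mixedTensor n) ?_
  rintro _ ⟨r, f, a, rfl⟩
  exact (hβ r f a).trans (hα r f a).symm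

/-! ### The isomorphism between `D` and the tensor power -/

/-- The map `P^{⊗n} → D`, `v_1 ⊗ ⋯ ⊗ v_n ↦ ∏ i, v_i(x_{i1}, …, x_{im})`. -/
def tensorToPoly (K : Type*) [CommRing K] (m n : ℕ) :
    (⨂[K] _ : Fin n, MvPolynomial (Fin m) K) →ₐ[K] MvPolynomial (Fin n × Fin m) K :=
  PiTensorProduct.liftAlgHom
    ((MultilinearMap.mkPiAlgebra K (Fin n) (MvPolynomial (Fin n × Fin m) K)).compLinearMap fun i =>
      (MvPolynomial.rename (Prod.mk i)).toLinearMap)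
    (by simp) (fun x y => by simp [Finset.prod_mul_distrib])

theorem tensorToPoly_tprod (K : Type*) [CommRing K] (m n : ℕ)
    (v : Fin n → MvPolynomial (Fin m) K) :
    tensorToPoly K m n (PiTensorProduct.tprod K v)
      = ∏ i, MvPolynomial.rename (Prod.mk i) (v i) :=
  (PiTensorProduct.lift.tprod v).trans (by simp)

theorem tensorToPoly_single (K : Type*) [CommRing K] (m n : ℕ) (i : Fin n)
    (f : MvPolynomial (Fin m) K) :
    tensorToPoly K m n (PiTensorProduct.singleAlgHom (R := K)
      (A := fun _ : Fin n => MvPolynomial (Fin m) K) i f) = MvPolynomial.rename (Prod.mk i) f := by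
  rw [PiTensorProduct.singleAlgHom_apply, tensorToPoly_tprod, Finset.prod_eq_single i]
  · simp
  · intro j _ hj
    simp [hj]
  · simp

/-- `multisymToTensor` as an isomorphism, with inverse `tensorToPoly`. -/
def multisymTensorEquiv (K : Type*) [CommRing K] (m n : ℕ) :
    MvPolynomial (Fin n × Fin m) K ≃ₐ[K] (⨂[K] _ : Fin n, MvPolynomial (Fin m) K) :=
  AlgEquiv.ofAlgHom (multisymToTensor K m n) (tensorToPoly K m n)
    (by
      refine PiTensorProduct.algHom_ext fun i => MvPolynomial.algHom_ext fun k => ?_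
      simp only [AlgHom.comp_apply, tensorToPoly_single, MvPolynomial.rename_X, AlgHom.id_apply]
      simp only [multisymToTensor, MvPolynomial.aeval_X])
    (by
      refine MvPolynomial.algHom_ext fun p => ?_
      simp only [AlgHom.comp_apply, multisymToTensor, MvPolynomial.aeval_X, tensorToPoly_single,
        MvPolynomial.rename_X, AlgHom.id_apply])

theorem permTensor_multisymToTensor (K : Type*) [CommRing K] (m n : ℕ)
    (σ : Equiv.Perm (Fin n)) (d : MvPolynomial (Fin n × Fin m) K) :
    permTensor K _ n σ (multisymToTensor K m n d)
      = multisymToTensor K m n (MvPolynomial.rename (Prod.map σ id) d) := by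
  suffices (permTensor K _ n σ).comp (multisymToTensor K m n)
      = (multisymToTensor K m n).comp (MvPolynomial.rename (Prod.map σ id)) from
    DFunLike.congr_fun this d
  refine MvPolynomial.algHom_ext fun p => ?_
  simp only [AlgHom.comp_apply, multisymToTensor, MvPolynomial.aeval_X, MvPolynomial.rename_X,
    PiTensorProduct.singleAlgHom_apply, permTensor_tprod, Prod.map_fst, Prod.map_snd, id]
  congr 1
  ext1 i
  simp [Pi.mulSingle_apply, Equiv.symm_apply_eq]

/-- The restriction of `multisymTensorEquiv` to invariants. -/
def multisymEquiv (K : Type*) [CommRing K] (m n : ℕ) :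
    multisymmetric K m n ≃ₐ[K] symTensor K (MvPolynomial (Fin m) K) n :=
  ((multisymTensorEquiv K m n).subalgebraMap (multisymmetric K m n)).trans
    (Subalgebra.equivOfEq _ _ (by
      ext z
      obtain ⟨d, rfl⟩ := (multisymTensorEquiv K m n).surjective z
      have h : ∀ σ, permTensor K _ n σ (multisymTensorEquiv K m n d) = multisymTensorEquiv K m n d ↔
          MvPolynomial.rename (Prod.map σ id) d = d := fun σ => by
        rw [← (multisymTensorEquiv K m n).injective.eq_iff]
        exact Eq.congr_left (permTensor_multisymToTensor K m n σ d)
      refine Iff.trans ?_ (forall_congr' h).symm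
      constructor
      · rintro ⟨d', hd', h'⟩
        rw [← (multisymTensorEquiv K m n).injective h']
        exact hd'
      · exact fun hd => ⟨d, hd, rfl⟩))

theorem coe_multisymEquiv {K : Type*} [CommRing K] {m n : ℕ} (d : multisymmetric K m n) :
    (multisymEquiv K m n d : ⨂[K] _ : Fin n, MvPolynomial (Fin m) K)
      = multisymToTensor K m n d := rfl

/-! ### Injectivity by specialization to diagonal matrices -/

/-- The homomorphism `A_P → D` specializing `ξ'_k` to the diagonal matrix with entries
`x_{1k}, …, x_{nk}`. -/
def diagonalPoint (K : Type*) [CommRing K] (m n : ℕ) :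
    CommutingRing K m n →ₐ[K] MvPolynomial (Fin n × Fin m) K :=
  Ideal.Quotient.liftₐ (commutingIdeal K m n)
    (MvPolynomial.aeval fun p => if p.2.1 = p.2.2 then MvPolynomial.X (p.2.1, p.1) else 0)
    (by
      suffices commutingIdeal K m n ≤ RingHom.ker (MvPolynomial.aeval
          (fun p : Fin m × Fin n × Fin n => if p.2.1 = p.2.2 then
            (MvPolynomial.X (p.2.1, p.1) : MvPolynomial (Fin n × Fin m) K) else 0)).toRingHom from
        fun a ha => this ha
      refine Ideal.span_le.2 ?_
      rintro _ ⟨k, h, i, j, rfl⟩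
      simp only [SetLike.mem_coe, RingHom.mem_ker]
      simp only [genericMatrix, AlgHom.toRingHom_eq_coe, RingHom.coe_coe, Matrix.sub_apply,
        Matrix.mul_apply, Matrix.of_apply, map_sub, map_sum, map_mul, MvPolynomial.aeval_X]
      by_cases hij : i = j
      · subst hij; simp [mul_comm]
      · simp [hij])

theorem map_diagonalPoint_commutingMatrix (K : Type*) [CommRing K] (m n : ℕ) (k : Fin m) :
    (commutingMatrix K m n k).map (diagonalPoint K m n)
      = Matrix.diagonal fun i => MvPolynomial.X (i, k) := by
  ext i j : 2
  have : diagonalPoint K m n (commutingMatrix K m n k i j)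
      = if i = j then MvPolynomial.X (i, k) else 0 :=
    MvPolynomial.aeval_X _ _
  rw [Matrix.map_apply, this, Matrix.diagonal_apply]

theorem map_diagonalPoint_piRep {K : Type*} [CommRing K] {m n : ℕ} (f : MvPolynomial (Fin m) K) :
    (piRep K m n f).map (diagonalPoint K m n)
      = Matrix.diagonal fun i => MvPolynomial.rename (Prod.mk i) f := by
  suffices (diagonalPoint K m n).mapMatrix.comp (piRep K m n)
      = (Matrix.diagonalAlgHom K).comp (AlgHom.pi fun i =>
        MvPolynomial.rename (Prod.mk i)) from DFunLike.congr_fun this f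
  refine MvPolynomial.algHom_ext fun k => ?_
  simp only [AlgHom.comp_apply, piRep_X, AlgHom.mapMatrix_apply, map_diagonalPoint_commutingMatrix]
  exact congrArg Matrix.diagonal (funext fun i => (MvPolynomial.rename_X _ _).symm)

/-- At the diagonal point the matrix of columns of `v_1 ⊗ ⋯ ⊗ v_n` is itself diagonal, with `i`-th
entry `v_i(x_{i1}, …, x_{im})`. -/
theorem diagonalPoint_columnDet {K : Type*} [CommRing K] {m n : ℕ}
    (z : ⨂[K] _ : Fin n, MvPolynomial (Fin m) K) :
    diagonalPoint K m n (columnDet K m n z) = tensorToPoly K m n z := by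
  induction z using PiTensorProduct.induction_on with
  | add x y hx hy => simp only [map_add, hx, hy]
  | smul_tprod k v =>
    rw [map_smul, map_smul, map_smul, columnDet_tprod, tensorToPoly_tprod, AlgHom.map_det,
      ← Matrix.det_diagonal]
    congr 2
    ext i j : 2
    have := congrFun (congrFun (map_diagonalPoint_piRep (n := n) (v j)) i) j
    rw [Matrix.map_apply] at this
    rw [AlgHom.mapMatrix_apply, Matrix.map_apply, Matrix.of_apply, this]
    by_cases hij : i = j
    · subst hij; simp
    · simp [hij]

theorem columnDet_injective (K : Type*) [CommRing K] (m n : ℕ) :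
    Function.Injective (columnDet K m n) := by
  refine Function.Injective.of_comp (f := diagonalPoint K m n) ?_
  rw [show diagonalPoint K m n ∘ columnDet K m n = (multisymTensorEquiv K m n).symm from
    funext diagonalPoint_columnDet]
  exact (multisymTensorEquiv K m n).symm.injective

/-! ### The image is generated by characteristic coefficients -/

/-- Modulo any power of `X`, a polynomial with constant coefficient `1` is a product of polynomials
`1 + C c * X ^ k` with `0 < k`. -/
theorem Polynomial.exists_prod_one_add_C_mul_X_pow {R : Type*} [CommRing R] (u : Polynomial R)
    (hu : u.coeff 0 = 1) (N : ℕ) :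
    ∃ w ∈ Submonoid.closure {p : Polynomial R | ∃ (c : R) (k : ℕ), p = 1 + C c * X ^ (k + 1)},
      w.coeff 0 = 1 ∧ X ^ (N + 1) ∣ u - w := by
  induction N with
  | zero => exact ⟨1, one_mem _, by simp, by rw [zero_add, pow_one, X_dvd_iff]; simp [hu]⟩
  | succ N ih =>
    obtain ⟨w, hw, hw0, q, hq⟩ := ih
    refine ⟨w * (1 + C (q.coeff 0) * X ^ (N + 1)), mul_mem hw (Submonoid.subset_closure ⟨_, _, rfl⟩),
      by simp [mul_coeff_zero, hw0], ?_⟩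
    have h : u - w * (1 + C (q.coeff 0) * X ^ (N + 1)) = X ^ (N + 1) * (q - w * C (q.coeff 0)) := by
      rw [mul_sub, ← hq]; ring
    rw [h, pow_succ]
    refine mul_dvd_mul_left _ (X_dvd_iff.2 ?_)
    simp [mul_coeff_zero, hw0]

theorem Matrix.dvd_det_sub_det {R N : Type*} [CommRing R] [DecidableEq N] [Fintype N] {d : R}
    {M M' : Matrix N N R} (h : ∀ i j, d ∣ M i j - M' i j) : d ∣ M.det - M'.det := by
  simp only [← Ideal.mem_span_singleton, ← Ideal.Quotient.eq] at h ⊢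
  rw [RingHom.map_det, RingHom.map_det]
  congr 1
  ext i j
  exact h i j

theorem RingHom.polyToMatrix_C_mul_X_pow {R S N : Type*} [CommRing R] [CommRing S] [DecidableEq N]
    [Fintype N] (φ : S →+* Matrix N N R) (c : S) (k : ℕ) :
    φ.polyToMatrix (Polynomial.C c * Polynomial.X ^ k)
      = (Polynomial.X ^ k : Polynomial R) • (φ c).map Polynomial.C := by
  have hX : φ.polyToMatrix Polynomial.X
      = Matrix.diagonal fun _ : N => (Polynomial.X : Polynomial R) := by
    simp [RingHom.polyToMatrix, -AlgEquiv.symm_toRingEquiv]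
  have hC : φ.polyToMatrix (Polynomial.C c) = (φ c).map Polynomial.C := by
    simp [RingHom.polyToMatrix, -AlgEquiv.symm_toRingEquiv]
  rw [map_mul, map_pow, hX, hC, Matrix.diagonal_pow]
  ext i j : 2
  rw [Matrix.mul_diagonal, Pi.pow_apply, Matrix.smul_apply, smul_eq_mul, mul_comm]

/-- `det (1 + t ^ k M)` is the reversed characteristic polynomial of `-M`, evaluated at `t ^ k`. -/
theorem Matrix.det_one_add_X_pow_smul_mem_lifts {R S N : Type*} [CommRing R] [CommRing S]
    [DecidableEq N] [Fintype N] (g : S →+* R) (M : Matrix N N R)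
    (hM : (-M).charpoly ∈ Polynomial.lifts g) (k : ℕ) :
    (1 + (Polynomial.X ^ k : Polynomial R) • M.map Polynomial.C).det ∈ Polynomial.lifts g := by
  have hrev : (-M).charpolyRev ∈ Polynomial.lifts g := by
    rw [← Matrix.reverse_charpoly, Polynomial.lifts_iff_coeff_lifts]
    intro e
    rw [Polynomial.coeff_reverse]
    exact (Polynomial.lifts_iff_coeff_lifts _).1 hM _
  have h : (1 + (Polynomial.X ^ k : Polynomial R) • M.map Polynomial.C).det
      = Polynomial.expand R k (-M).charpolyRev := by
    rw [Matrix.charpolyRev, AlgHom.map_det]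
    congr 1
    ext i j : 2
    simp [Matrix.one_apply, apply_ite (Polynomial.expand R k)]
  obtain ⟨q, hq⟩ := (Polynomial.mem_lifts _).1 hrev
  rw [h, ← hq, ← Polynomial.map_expand]
  exact (Polynomial.mem_lifts _).2 ⟨_, rfl⟩

/-- The coefficient of `t^e` in `det (u(ξ'))` depends only on `u` modulo `t^{e+1}`, where `u` may be
replaced by a product of factors `1 + c t^k`. -/
theorem coeff_det_polyToMatrix_mem_charSubalgebra {K : Type*} [CommRing K] {m n : ℕ}
    (u : Polynomial (MvPolynomial (Fin m) K)) (hu : u.coeff 0 = 1) (e : ℕ) :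
    ((piRep K m n).toRingHom.polyToMatrix u).det.coeff e ∈ charSubalgebra K m n := by
  set φ := (piRep K m n).toRingHom.polyToMatrix with hφ
  obtain ⟨w, hw, -, hdvd⟩ := u.exists_prod_one_add_C_mul_X_pow hu e
  have hw' : (φ w).det ∈ Polynomial.lifts (charSubalgebra K m n).val.toRingHom := by
    clear hdvd
    induction hw using Submonoid.closure_induction with
    | one => rw [map_one, Matrix.det_one]; exact one_mem _
    | mul x y _ _ hx hy => rw [map_mul, Matrix.det_mul]; exact mul_mem hx hy
    | mem x hx =>
      obtain ⟨c, k, rfl⟩ := hx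
      rw [map_add, map_one, hφ, RingHom.polyToMatrix_C_mul_X_pow]
      refine Matrix.det_one_add_X_pow_smul_mem_lifts _ _ ?_ _
      refine (Polynomial.lifts_iff_coeff_lifts _).2 fun j => ⟨⟨_, ?_⟩, rfl⟩
      exact Algebra.subset_adjoin ⟨-c, j, by rw [map_neg]; rfl⟩
  have hcongr : (Polynomial.X ^ (e + 1)) ∣ (φ u).det - (φ w).det := by
    refine Matrix.dvd_det_sub_det fun i j => ?_
    obtain ⟨q, hq⟩ := hdvd
    have hX := RingHom.polyToMatrix_C_mul_X_pow (piRep K m n).toRingHom 1 (e + 1)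
    have h1 : (1 : Matrix (Fin n) (Fin n) (CommutingRing K m n)).map Polynomial.C = 1 := by simp
    rw [map_one, one_mul, map_one, h1, ← hφ] at hX
    have hsub : φ u i j - φ w i j = φ (u - w) i j := by rw [map_sub]; rfl
    rw [hsub, hq, map_mul, hX, smul_mul_assoc, one_mul, Matrix.smul_apply]
    exact dvd_mul_right _ _
  have he : (φ u).det.coeff e = (φ w).det.coeff e := by
    rw [← sub_eq_zero, ← Polynomial.coeff_sub]
    exact Polynomial.X_pow_dvd_iff.1 hcongr e e.lt_succ_self
  obtain ⟨⟨x, hx⟩, hxe⟩ := (Polynomial.lifts_iff_coeff_lifts _).1 hw' e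
  rw [he, ← hxe]
  exact hx

/-- Uniqueness of expansions in base `B`. -/
theorem eq_of_sum_mul_pow_eq {r B : ℕ} {x y : Fin r → ℕ} (hx : ∀ j, x j < B) (hy : ∀ j, y j < B)
    (h : ∑ j, x j * B ^ (j : ℕ) = ∑ j, y j * B ^ (j : ℕ)) : x = y := by
  have : (fun j => (⟨x j, hx j⟩ : Fin B)) = fun j => ⟨y j, hy j⟩ :=
    finFunctionFinEquiv.injective (Fin.ext (by simpa [finFunctionFinEquiv_apply] using h))
  funext j
  exact congrArg Fin.val (congrFun this j)

/-- The exponent `∑ j, a j * (n + 1) ^ j` in `(1 + ∑ j, t ^ ((n + 1) ^ j) f_j)^{⊗n}` comes only from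
choices of terms of content `a`. As `a` has total degree `n`, such a choice never takes the
summand `1`, represented by `none`. -/
theorem eq_some_comp_of_sum_eq {n r : ℕ} {a : Fin r →₀ ℕ} (ha : ∑ j, a j = n)
    {c : Fin n → Option (Fin r)}
    (hc : ∑ k, (c k).elim 0 (fun j => (n + 1) ^ (j : ℕ)) = ∑ j, a j * (n + 1) ^ (j : ℕ)) :
    ∃ d : Fin n → Fin r, c = (fun k => some (d k)) ∧ ∑ k, Finsupp.single (d k) 1 = a := by
  classical
  let x : Fin r → ℕ := fun j => ∑ k, if c k = some j then 1 else 0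
  have hx : x = a := by
    refine eq_of_sum_mul_pow_eq (B := n + 1) (fun j => Nat.lt_succ_of_le ?_)
      (fun j => Nat.lt_succ_of_le ?_) (Eq.trans ?_ hc)
    · exact (Finset.sum_le_sum fun k _ => by split_ifs <;> simp).trans
        (by simp : ∑ _k : Fin n, 1 ≤ n)
    · exact (Finset.single_le_sum (fun _ _ => Nat.zero_le _) (Finset.mem_univ j)).trans ha.le
    · simp only [x, Finset.sum_mul]
      rw [Finset.sum_comm]
      refine Finset.sum_congr rfl fun k _ => ?_
      cases c k <;> simp [ite_mul]
  have hsome : ∀ k, (c k).isSome := by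
    by_contra! hk
    obtain ⟨k₀, hk₀⟩ := hk
    have h1 : ∑ k, (if (c k).isSome then 1 else 0) = n := by
      refine Eq.trans ?_ ha
      rw [← hx, Finset.sum_comm]
      refine Finset.sum_congr rfl fun k _ => ?_
      cases c k <;> simp
    have h2 : ∑ k, (if (c k).isSome then 1 else 0) < ∑ _k : Fin n, 1 :=
      Finset.sum_lt_sum (fun k _ => by split_ifs <;> simp) ⟨k₀, Finset.mem_univ _, by simp [hk₀]⟩
    simp [h1] at h2
  choose d hd using fun k => Option.isSome_iff_exists.1 (hsome k)
  refine ⟨d, funext hd, ?_⟩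
  ext j
  rw [← hx, Finsupp.finsetSum_apply]
  refine Finset.sum_congr rfl fun k _ => ?_
  simp [hd, Finsupp.single_apply]

theorem sum_single_mul_pow {n r B : ℕ} (d : Fin n → Fin r) :
    ∑ j, (∑ k, Finsupp.single (d k) 1 : Fin r →₀ ℕ) j * B ^ (j : ℕ) = ∑ k, B ^ (d k : ℕ) := by
  classical
  simp only [Finsupp.finsetSum_apply, Finset.sum_mul]
  rw [Finset.sum_comm]
  simp [Finsupp.single_apply]

/-- The family `f` is encoded in the one-variable polynomial `u = 1 + ∑ j, t ^ ((n + 1) ^ j) f_j`. -/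
theorem columnDet_mixedTensor_mem_charSubalgebra {K : Type*} [CommRing K] {m n r : ℕ}
    (f : Fin r → MvPolynomial (Fin m) K) (a : Fin r →₀ ℕ) :
    columnDet K m n (mixedTensor K n f a) ∈ charSubalgebra K m n := by
  classical
  -- Only contents of total degree `n` occur in the `n`-th tensor power.
  by_cases ha : ∑ j, a j = n
  swap
  · have : mixedTensor K n f a = 0 := Subtype.ext (Finset.sum_eq_zero fun c _ => if_neg fun h => ha
      (by simp [← h, Finsupp.finsetSum_apply, Finset.sum_comm (γ := Fin r)]))
    rw [this, ZeroMemClass.coe_zero, map_zero]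
    exact zero_mem _
  let w : Option (Fin r) → ℕ := fun o => o.elim 0 fun j => (n + 1) ^ (j : ℕ)
  let F : Option (Fin r) → MvPolynomial (Fin m) K := fun o => o.elim 1 f
  let u : Polynomial (MvPolynomial (Fin m) K) := ∑ o, Polynomial.C (F o) * Polynomial.X ^ w o
  have hu : u.coeff 0 = 1 := by
    have h0 : ∀ j : Fin r, 0 ≠ (n + 1) ^ (j : ℕ) := fun j => (pow_pos n.succ_pos _).ne
    simp [u, w, F, Fintype.sum_option, Polynomial.finsetSum_coeff, Polynomial.coeff_X_pow, h0]
  have hφ : (piRep K m n).toRingHom.polyToMatrix u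
      = ∑ o, (Polynomial.X ^ w o : Polynomial (CommutingRing K m n)) •
          (piRep K m n (F o)).map Polynomial.C := by
    simp only [u, map_sum, RingHom.polyToMatrix_C_mul_X_pow]
    rfl
  have hmem := coeff_det_polyToMatrix_mem_charSubalgebra (n := n) u hu
    (∑ j, a j * (n + 1) ^ (j : ℕ))
  rw [hφ, Matrix.coeff_det_sum_X_pow_smul (fun o => piRep K m n (F o))] at hmem
  convert hmem using 1
  rw [mixedTensor, map_sum]
  have hinj : Function.Injective fun (d : Fin n → Fin r) (k : Fin n) => some (d k) :=
    fun d d' h => funext fun k => Option.some_injective _ (congrFun h k)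
  rw [← Finset.sum_subset (Finset.subset_univ (Finset.univ.map ⟨_, hinj⟩)), Finset.sum_map]
  · refine Finset.sum_congr rfl fun d _ => ?_
    have hd : ∑ k, Finsupp.single (d k) 1 = a ↔
        ∑ k, w (some (d k)) = ∑ j, a j * (n + 1) ^ (j : ℕ) := by
      constructor
      · rintro rfl
        exact (sum_single_mul_pow d).symm
      · intro h
        obtain ⟨d', hd', h'⟩ := eq_some_comp_of_sum_eq ha h
        rwa [hinj hd']
    simp only [Function.Embedding.coeFn_mk, hd]
    split_ifs
    · exact columnDet_tprod K m n _
    · exact map_zero _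
  · intro c _ hc
    refine if_neg fun h => hc ?_
    obtain ⟨d, rfl, -⟩ := eq_some_comp_of_sum_eq ha h
    exact Finset.mem_map_of_mem _ (Finset.mem_univ d)

theorem charpoly_coeff_mem_range {K : Type*} [CommRing K] {m n : ℕ} (f : MvPolynomial (Fin m) K)
    (e : ℕ) : (piRep K m n f).charpoly.coeff e ∈ (symTensorDet K m n).range := by
  classical
  -- `t - f` is the combination of `1` and `-f` with coefficients `t ^ 1` and `t ^ 0`.
  let w : Fin 2 → ℕ := ![1, 0]
  let F : Fin 2 → MvPolynomial (Fin m) K := ![1, -f]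
  have hdet : (piRep K m n f).charpoly
      = (∑ j, (Polynomial.X ^ w j : Polynomial (CommutingRing K m n)) •
          (piRep K m n (F j)).map Polynomial.C).det := by
    rw [Matrix.charpoly]
    congr 1
    ext i j : 2
    simp [w, F, Matrix.charmatrix, Matrix.diagonal_apply, Matrix.one_apply, sub_eq_add_neg]
  let g : (Fin n → Fin 2) → K := fun c => if ∑ k, w (c k) = e then 1 else 0
  have hg : ∀ (c : Fin n → Fin 2) (σ : Equiv.Perm (Fin n)), g (c ∘ σ) = g c := fun c σ => by
    simp only [g, Function.comp_apply, Equiv.sum_comp σ fun k => w (c k)]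
  refine ⟨⟨_, sum_smul_tprod_mem_symTensor F g hg⟩, ?_⟩
  rw [hdet, Matrix.coeff_det_sum_X_pow_smul (fun j => piRep K m n (F j))]
  refine (map_sum (columnDet K m n) _ _).trans (Finset.sum_congr rfl fun c _ => ?_)
  rw [map_smul, columnDet_tprod, ite_smul, one_smul, zero_smul]

theorem range_symTensorDet (K : Type*) [CommRing K] (m n : ℕ) :
    (symTensorDet K m n).range = charSubalgebra K m n := by
  refine le_antisymm ?_ (Algebra.adjoin_le ?_)
  · rintro _ ⟨z, rfl⟩
    have hz : z ∈ (⊤ : Submodule K (symTensor K (MvPolynomial (Fin m) K) n)) := trivial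
    rw [← span_mixedTensor] at hz
    refine (Submodule.span_le (p := (Subalgebra.toSubmodule (charSubalgebra K m n)).comap
      (symTensorDet K m n).toLinearMap)).2 ?_ hz
    rintro _ ⟨r, f, a, rfl⟩
    exact columnDet_mixedTensor_mem_charSubalgebra f a
  · rintro _ ⟨f, e, rfl⟩
    exact charpoly_coeff_mem_range f e

end

theorem theorem1 (K : Type*) [CommRing K] (m n : ℕ) :
    ∃ α : symTensor K (MvPolynomial (Fin m) K) n →ₐ[K] CommutingRing K m n,
      (∀ f : MvPolynomial (Fin m) K, α (powTensor K n f) = (piRep K m n f).det) ∧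
      RepresentsDet K m n α ∧
      (∀ β : symTensor K (MvPolynomial (Fin m) K) n →ₐ[K] CommutingRing K m n,
        RepresentsDet K m n β → β = α) ∧
      (∃ Φ : symTensor K (MvPolynomial (Fin m) K) n ≃ₐ[K] charSubalgebra K m n,
        ∀ z, (Φ z : CommutingRing K m n) = α z) ∧
      (∃ (Θ : multisymmetric K m n ≃ₐ[K] symTensor K (MvPolynomial (Fin m) K) n)
          (Ψ : multisymmetric K m n ≃ₐ[K] charSubalgebra K m n),
        (∀ d, (Θ d : ⨂[K] _ : Fin n, MvPolynomial (Fin m) K) =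
          multisymToTensor K m n (d : MvPolynomial (Fin n × Fin m) K)) ∧
        ∀ d, (Ψ d : CommutingRing K m n) = α (Θ d)) := by
  have hinj : Function.Injective (symTensorDet K m n) :=
    (columnDet_injective K m n).comp Subtype.val_injective
  let Φ : symTensor K (MvPolynomial (Fin m) K) n ≃ₐ[K] charSubalgebra K m n :=
    (AlgEquiv.ofInjective (symTensorDet K m n) hinj).trans
      (Subalgebra.equivOfEq _ _ (range_symTensorDet K m n))
  exact ⟨symTensorDet K m n, symTensorDet_powTensor K m n, representsDet_symTensorDet K m n,
    fun _ hβ => (representsDet_symTensorDet K m n).unique hβ, ⟨Φ, fun _ => rfl⟩,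
    multisymEquiv K m n, (multisymEquiv K m n).trans Φ, coe_multisymEquiv, fun _ => rfl⟩
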